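/- Theorem. For nonzero integers $d_1,\dots,d_l$ let $D(d_1,\dots,d_l)$ denote the trigonal diagram (Conway's open form): a diagram of a long link with three strands, two of which are joined on the left by an arc while the lowest one comes from infinity. Reading from left to right, it consists of $|d_1|$ half twists of the two lower strands, then $|d_2|$ half twists of the two upper strands, then $|d_3|$ half twists of the two lower strands, and so on. The twists are right-handed if $d_i>0$ with $i$ odd or $d_i<0$ with $i$ even, and left-handed otherwise. On the right, the two upper strands are joined if $l$ is odd and the two lower strands if $l$ is even, and the third strand goes to infinity. It is a diagram of the link obtained by joining its two ends at infinity. A link $K$ has Conway normal form $C(m_1,\dots,m_k)$, where all $m_i>0$, if $D(m_1,\dots,m_k)$ is a diagram of $K$. The diagram $D(d_1,\dots,d_l)$ is called hard if the $d_i$ are neither all positive nor all negative (so that the diagram is not alternating) and every Reidemeister move that can be applied to it (up to planar isotopy of diagrams) increases the number of crossings. Let $K$ be a two-bridge link of Conway normal form $C(m_1,\dots,m_k)$ with $k\ge 3$, all $m_i>0$, $m_1\ge 2$ and $m_k\ge 2$. Then $K$ has a hard trigonal diagram. More precisely, write $(m_1,\dots,m_k)=(x,m,a,n)$, where $x=(m_1,\dots,m_{k-3})$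 is possibly empty. Then $$D\bigl(x,\;m+1,\;\underbrace{-2,\;2,\;\dots,\;(-1)^{a-1}2}_{a-1\text{ terms}},\;(-1)^a(n+1)\bigr)$$ is a diagram of $K$, and it is hard. -/

import Mathlib

/-!
Link and tangle diagrams in the plane, in general position with respect to the horizontal
coordinate, read from left to right as words of elementary slices; their planar isotopies and
Reidemeister moves; Conway's open (trigonal) form of two-bridge links.

At a generic abscissa the strands are numbered `0, 1, 2, …` from bottom to top.
-/

namespace Trigonal

/-- The elementary pieces of a diagram. `cup` is an arc `⊂` where two new strands appear, `cap` is
an arc `⊃` where two neighbouring strands are joined, and `cross b` is a crossing of two neighbouring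
strands: for `b = true` the strand that goes up (from left to right) passes under the one
that goes down (a right-handed half twist), for `b = false` it passes over it (a left-handed half
twist). -/
inductive Piece
  | cup
  | cap
  | cross (right : Bool)
  deriving DecidableEq

/-- Number of strands on the left side of a piece. -/
def Piece.source : Piece → ℕ
  | .cup => 0
  | .cap => 2
  | .cross _ => 2

/-- Number of strands on the right side of a piece. -/
def Piece.target : Piece → ℕ
  | .cup => 2
  | .cap => 0
  | .cross _ => 2

/-- An elementary slice: the given piece, with `pos` horizontal strands below it (and some number of
horizontal strands above it). -/
structure Slice where
  piece : Piece
  pos : ℕ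
  deriving DecidableEq

/-- Two new strands appear, at positions `i` and `i + 1`. -/
abbrev cup (i : ℕ) : Slice := ⟨.cup, i⟩

/-- The strands at positions `i` and `i + 1` are joined. -/
abbrev cap (i : ℕ) : Slice := ⟨.cap, i⟩

/-- The strands at positions `i` and `i + 1` cross. -/
abbrev cross (i : ℕ) (right : Bool) : Slice := ⟨.cross right, i⟩

/-- The slices of `w`, put side by side from left to right, fit together to a diagram with `p`
strands at its left end and `q` strands at its right end. -/
inductive Fits : ℕ → List Slice → ℕ → Prop
  | nil (p : ℕ) : Fits p [] p
  | cons (s : Slice) (r : ℕ) (w : List Slice) (q : ℕ)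
      (h : Fits (s.pos + s.piece.target + r) w q) :
      Fits (s.pos + s.piece.source + r) (s :: w) q

/-- Unoriented tangle diagrams with `p` left end points and `q` right end points. -/
structure TangleDiagram (p q : ℕ) where
  word : List Slice
  fits : Fits p word q

/-- Diagrams of (closed) links. -/
abbrev LinkDiagram := TangleDiagram 0 0

/-- Diagrams of long links: one strand comes from infinity on the left and one
strand goes to infinity on the right. -/
abbrev LongDiagram := TangleDiagram 1 1

/-- The number of crossings of a word. -/
def crossingCount (w : List Slice) : ℕ :=
  w.countP fun s => s.piece = .cross true ∨ s.piece = .cross false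

/-- The number of crossings of a diagram. -/
def TangleDiagram.crossings {p q : ℕ} (D : TangleDiagram p q) : ℕ := crossingCount D.word

/-- The elementary planar isotopies. -/
inductive PlanarRule : List Slice → List Slice → Prop
  /-- A slice and a slice that lies above it exchange their abscissae. -/
  | exchange (g h : Piece) (i d : ℕ) :
      PlanarRule [⟨g, i⟩, ⟨h, i + g.target + d⟩] [⟨h, i + g.source + d⟩, ⟨g, i⟩]
  /-- A zigzag is straightened. -/
  | zigzag_up (i : ℕ) : PlanarRule [cup i, cap (i + 1)] []
  | zigzag_down (i : ℕ) : PlanarRule [cup (i + 1), cap i] []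
  /-- A crossing slides along an arc, through its leftmost point. -/
  | slide_cup (i : ℕ) (b : Bool) :
      PlanarRule [cup i, cross (i + 1) b] [cup (i + 1), cross i (!b)]
  /-- A crossing slides along an arc, through its rightmost point. -/
  | slide_cap (i : ℕ) (b : Bool) :
      PlanarRule [cross (i + 1) b, cap i] [cross i (!b), cap (i + 1)]

/-- The Reidemeister moves, up to planar isotopy, and each in one direction. -/
inductive ReidemeisterRule : List Slice → List Slice → Prop
  /-- First move: a curl is removed. -/
  | one (i : ℕ) (b : Bool) : ReidemeisterRule [cross i b, cap i] [cap i]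
  /-- Second move: two strands, one of which lies entirely over the other, are pulled apart. -/
  | two (i : ℕ) (b : Bool) : ReidemeisterRule [cross i b, cross i (!b)] []
  /-- Third move: one strand moves over or under the crossing of two others. The two alternating
  triples of signs are excluded; for these there is no highest strand. -/
  | three (i : ℕ) (a b c : Bool) (h : ¬ (a = c ∧ b ≠ a)) :
      ReidemeisterRule [cross i a, cross (i + 1) b, cross i c]
        [cross (i + 1) c, cross i b, cross (i + 1) a]

/-- `D'` results from `D` if somewhere in `D` a left side of a rule is replaced by the right side. -/
def Replaces (R : List Slice → List Slice → Prop) {p q : ℕ} (D D' : TangleDiagram p q) : Prop :=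
  ∃ u l r v : List Slice, R l r ∧ D.word = u ++ l ++ v ∧ D'.word = u ++ r ++ v

/-- Isotopy of diagrams in the plane (with fixed end points). -/
def PlanarIsotopic {p q : ℕ} : TangleDiagram p q → TangleDiagram p q → Prop :=
  Relation.EqvGen (Replaces PlanarRule)

/-- `D'` is obtained from `D` by applying one Reidemeister move, in either direction.
Diagrams are considered up to planar isotopy. -/
def ReidemeisterMove {p q : ℕ} (D D' : TangleDiagram p q) : Prop :=
  ∃ E E' : TangleDiagram p q, PlanarIsotopic D E ∧
    (Replaces ReidemeisterRule E E' ∨ Replaces ReidemeisterRule E' E) ∧ PlanarIsotopic E' D'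

/-- Two diagrams represent isotopic links (or tangles): they are connected by planar isotopies and
Reidemeister moves. -/
def SameLink {p q : ℕ} : TangleDiagram p q → TangleDiagram p q → Prop :=
  Relation.EqvGen fun D D' => PlanarIsotopic D D' ∨ ReidemeisterMove D D'

theorem Fits.append {p q r : ℕ} {w w' : List Slice} (h : Fits p w q) (h' : Fits q w' r) :
    Fits p (w ++ w') r := by
  induction h with
  | nil => exact h'
  | cons s k w q _ ih => exact Fits.cons s k _ _ (ih h')

theorem Fits.widen {p q : ℕ} {w : List Slice} (h : Fits p w q) (t : ℕ) :
    Fits (p + t) w (q + t) := by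
  induction h with
  | nil => exact Fits.nil _
  | cons s k w q _ ih =>
    rw [Nat.add_assoc] at ih ⊢
    exact Fits.cons s (k + t) w _ ih

/-- The closed link diagram obtained from a long one by joining its two ends by an arc that
passes above the diagram. -/
def closeUp (D : LongDiagram) : LinkDiagram where
  word := [cup 0] ++ D.word ++ [cap 0]
  fits := ((Fits.cons (cup 0) 0 [] 2 (Fits.nil 2)).append (D.fits.widen 1)).append
    (Fits.cons (cap 0) 0 [] 0 (Fits.nil 0))

/-- The twists of Conway's form. With `odd = true` the list starts at an odd index. The terms with
odd index are twists of the two lower strands, positive if right-handed; those with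
even index are twists of the two upper strands, positive if left-handed. -/
def twists : Bool → List ℤ → List Slice
  | _, [] => []
  | true, m :: l => List.replicate m.natAbs (cross 0 (decide (0 < m))) ++ twists false l
  | false, m :: l => List.replicate m.natAbs (cross 1 (decide (m < 0))) ++ twists true l

theorem fits_replicate (i : ℕ) (hi : i ≤ 1) (b : Bool) (n : ℕ) :
    Fits 3 (List.replicate n (cross i b)) 3 := by
  induction n with
  | zero => exact Fits.nil 3
  | succ n ih =>
    have h : i + 2 + (1 - i) = 3 := by omega
    have key := Fits.cons (cross i b) (1 - i) (List.replicate n (cross i b)) 3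
    simp only [Piece.source, Piece.target, h] at key
    exact key ih

theorem fits_twists (odd : Bool) (l : List ℤ) : Fits 3 (twists odd l) 3 := by
  induction l generalizing odd with
  | nil => cases odd <;> exact Fits.nil 3
  | cons m l ih =>
    cases odd
    · exact (fits_replicate 1 le_rfl _ _).append (ih true)
    · exact (fits_replicate 0 zero_le_one _ _).append (ih false)

/-- The arc on the right of Conway's form: the strand that goes to infinity is the lowest of the
three for an odd number of terms, and the highest for an even number of terms. -/
def lastCap (l : List ℤ) : Slice := if Odd l.length then cap 1 else cap 0

theorem fits_lastCap (l : List ℤ) : Fits 3 [lastCap l] 1 := by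
  unfold lastCap
  split
  · exact Fits.cons (cap 1) 0 [] 1 (Fits.nil 1)
  · exact Fits.cons (cap 0) 1 [] 1 (Fits.nil 1)

/-- The trigonal diagram `D(m₁, …, m_k)` (Conway's open form). The lowest of the three strands
comes from infinity on the left, and the two others are joined on the left. -/
def conway (l : List ℤ) : LongDiagram where
  word := [cup 1] ++ twists true l ++ [lastCap l]
  fits := ((Fits.cons (cup 1) 0 [] 3 (Fits.nil 3)).append (fits_twists true l)).append
    (fits_lastCap l)

/-- `D(m₁, …, m_k)` is a diagram of the link `K`, which is given by one of its diagrams. -/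
def IsConwayDiagramOf (l : List ℤ) (K : LinkDiagram) : Prop := SameLink (closeUp (conway l)) K

/-- `K` has Conway normal form `C(m₁, …, m_k)`, for positive integers `mᵢ`. -/
def HasConwayNormalForm (K : LinkDiagram) (l : List ℤ) : Prop :=
  (∀ m ∈ l, 0 < m) ∧ IsConwayDiagramOf l K

/-- `D(m₁, …, m_k)` is alternating: all terms have the same sign. -/
def IsAlternating (l : List ℤ) : Prop := (∀ m ∈ l, 0 < m) ∨ (∀ m ∈ l, m < 0)

/-- `D(m₁, …, m_k)`, with nonzero integers `mᵢ`, is a hard trigonal diagram: it is not alternating,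
and every Reidemeister move that can be applied to it increases the number of crossings. -/
structure IsHard (l : List ℤ) : Prop where
  ne_zero : ∀ m ∈ l, m ≠ 0
  not_alternating : ¬ IsAlternating l
  crossings_lt : ∀ E : LongDiagram, ReidemeisterMove (conway l) E →
    (conway l).crossings < E.crossings

/-- The sequence `x, m + 1, -2, 2, …, (-1)^(a-1) 2, (-1)^a (n + 1)`, with `a - 1` terms `±2`. -/
def hardSequence (x : List ℤ) (m : ℤ) (a : ℕ) (n : ℤ) : List ℤ :=
  x ++ [m + 1] ++ (List.range (a - 1)).map (fun j => (-1) ^ (j + 1) * 2) ++ [(-1) ^ a * (n + 1)]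

end Trigonal

open Trigonal

/-!
The two claims are independent.

*The two diagrams represent the same link.* As braids on three strands closed by a cap on the right,
both long diagrams agree up to a common left part. Write the block of `m` twists as `m + 1` twists
followed by an inverse crossing `σ⁻¹`. Then `flype` shows `σ⁻¹ τ⁻ᵃ σⁿ = τ σ¹⁻ᵃ τⁿ` in front of the
caps that belong to the two parities. Its proof uses only that a pair `σ⁻¹ τ⁻¹` moves through
crossings (`gen_pair_replicate`, third moves) and that in front of one cap it amounts to `τ` in
front of the other one (`gen_pair_cap`). The right side is `τ² (τ⁻¹ σ¹⁻ᵃ τⁿ)`, so the argument can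
be repeated with `a - 1` and with `σ`, `τ` exchanged; each step produces one of the terms `± 2`
(`sameTangle_zigzagSeq`).

*The diagram is hard.* A corner of a region at a crossing has one of two types, according to whether
the over-strand sweeps over it when it is turned counterclockwise or clockwise; a diagram is
alternating if each region has corners of one type only. The moves that do not increase the number
of crossings need a monogon, a bigon with corners of both types, or a triangle with corners of both
types. In order to have an invariant of planar isotopy that can be read off from words, regions are
replaced by unions of regions: a shading (`Shades`) colours the gaps between strands along the word,
and its weight counts its corners of either type. The set of weights of the shadings that vanish at
both ends is invariant under planar isotopy (`PlanarIsotopic.shades_iff`), and the weights that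
occur for the moves lie outside the submonoid `Allowed` of `ℕ × ℕ`. It remains to see that each
bounded region of the hard diagram has an allowed weight (`crossings_lt_of_allowed`). This is an
induction from right to left over the blocks of twists, which keeps track of the two regions that
are still open on the left (`Tame`). The signs `-2, 2, -2, …` mean that in the tail all crossings
are twisted in the same direction, so that there all regions other than the bigons inside blocks
have corners of both types, but these regions have at least four corners, since `m + 1 ≥ 2` (and `m
+ 1 ≥ 3` if the sequence starts with this term) and `n + 1 ≥ 3`. The remaining part is alternating.
-/

namespace Trigonal

/-! ### Shadings of the regions of a diagram -/

/-- The shading `g'` of the gaps on the right of the slice `s` continues the shading `g` on its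
left: the gaps below and above the piece keep their shades. Gaps between strands are numbered from
bottom to top, gap `i` lying directly below strand `i`. For a cup or a cap the two conditions
overlap in one gap, which says that the region outside the arc is one region. -/
def Continues (s : Slice) (g g' : ℕ → Bool) : Prop :=
  (∀ k ≤ s.pos, g' k = g k) ∧
    ∀ k, g' (s.pos + s.piece.target + k) = g (s.pos + s.piece.source + k)

/-- The weight of a corner of type `b`: the first component counts corners of type `true`, the
second one corners of type `false`. -/
def oneCorner (b : Bool) : ℕ × ℕ := if b then (1, 0) else (0, 1)

/-- The contribution `u`, if the region is shaded. -/
def shaded (x : Bool) (u : ℕ × ℕ) : ℕ × ℕ := if x then u else 0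

/-- The number of shaded corners of each type at a slice. The left and the right corner of `cross b`
have type `b`, the lower and the upper one have type `!b`; so a quarter turn, which exchanges `cross
true` and `cross false`, preserves types. -/
def weight (s : Slice) (g g' : ℕ → Bool) : ℕ × ℕ :=
  match s.piece with
  | .cross b => shaded (g (s.pos + 1)) (oneCorner b) + shaded (g' (s.pos + 1)) (oneCorner b) +
      (shaded (g s.pos) (oneCorner (!b)) + shaded (g (s.pos + 2)) (oneCorner (!b)))
  | _ => 0

/-- The diagram `w` has a shading of its regions which is `g` on the left and `g'` on the right and
has `k` shaded corners. -/
def Shades : List Slice → (ℕ → Bool) → ℕ × ℕ → (ℕ → Bool) → Prop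
  | [], g, k, g' => g = g' ∧ k = 0
  | s :: w, g, k, g' => ∃ h l, Continues s g h ∧ Shades w h l g' ∧ k = weight s g h + l

theorem shades_append {u v : List Slice} {g g' : ℕ → Bool} {k : ℕ × ℕ} :
    Shades (u ++ v) g k g' ↔ ∃ h a b, Shades u g a h ∧ Shades v h b g' ∧ k = a + b := by
  induction u generalizing g k with
  | nil =>
    constructor
    · intro h
      exact ⟨g, 0, k, ⟨rfl, rfl⟩, h, (zero_add k).symm⟩
    · rintro ⟨h, a, b, ⟨rfl, rfl⟩, h2, rfl⟩
      simpa using h2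
  | cons s u ih =>
    constructor
    · rintro ⟨h, l, h1, h2, rfl⟩
      obtain ⟨h', a, b, h3, h4, rfl⟩ := ih.1 h2
      exact ⟨h', weight s g h + a, b, ⟨h, a, h1, h3, rfl⟩, h4, (add_assoc _ _ _).symm⟩
    · rintro ⟨h', a, b, ⟨h, l, h1, h2, rfl⟩, h3, rfl⟩
      exact ⟨h, l + b, h1, ih.2 ⟨h', l, b, h2, h3, rfl⟩, add_assoc _ _ _⟩

theorem shades_pair {s t : Slice} {g g' : ℕ → Bool} {k : ℕ × ℕ} :
    Shades [s, t] g k g' ↔ ∃ h, Continues s g h ∧ Continues t h g' ∧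
      k = weight s g h + weight t h g' := by
  constructor
  · rintro ⟨h, l, h1, ⟨h', l', h2, ⟨rfl, rfl⟩, rfl⟩, rfl⟩
    exact ⟨h, h1, h2, by simp⟩
  · rintro ⟨h, h1, h2, rfl⟩
    exact ⟨h, _, h1, ⟨g', 0, h2, ⟨rfl, rfl⟩, rfl⟩, by simp⟩

/-- The weight of a slice only depends on the shades of the gaps that touch its piece. -/
theorem weight_congr {p : Piece} {i j : ℕ} {g g' h h' : ℕ → Bool}
    (hl : ∀ k ≤ p.source, g (i + k) = h (j + k)) (hr : ∀ k ≤ p.target, g' (i + k) = h' (j + k)) :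
    weight ⟨p, i⟩ g g' = weight ⟨p, j⟩ h h' := by
  cases p with
  | cup => rfl
  | cap => rfl
  | cross b =>
    have h0 := hl 0 (by simp [Piece.source])
    have h1 := hl 1 (by simp [Piece.source])
    have h2 := hl 2 (by simp [Piece.source])
    have h3 := hr 1 (by simp [Piece.target])
    simp only [add_zero] at h0
    simp only [weight, h0, h1, h2, h3]

theorem shades_exchange (p q : Piece) (i d : ℕ) {g g' : ℕ → Bool} {k : ℕ × ℕ} :
    Shades [⟨p, i⟩, ⟨q, i + p.target + d⟩] g k g' ↔
      Shades [⟨q, i + p.source + d⟩, ⟨p, i⟩] g k g' := by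
  simp only [shades_pair, Continues]
  constructor
  · rintro ⟨h, ⟨a1, a2⟩, ⟨b1, b2⟩, rfl⟩
    -- Left of the overlap the intermediate shading is `g`, right of it a shift of `g'`.
    refine ⟨fun k => if k ≤ i + p.source + d then g k else g' (k - p.source - i + p.target + i),
      ⟨?_, ?_⟩, ⟨?_, ?_⟩, ?_⟩
    · intro k hk; dsimp only at hk ⊢; rw [if_pos hk]
    · intro k
      dsimp only
      have e : g' (i + p.target + d + q.target + k) = g (i + p.source + d + q.source + k) := by
        rw [b2, show i + p.target + d + q.source + k = i + p.target + (d + q.source + k) by omega,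
          a2, show i + p.source + (d + q.source + k) = i + p.source + d + q.source + k by omega]
      split_ifs with hk
      · have : q.target = 0 := by omega
        have : k = 0 := by omega
        subst this
        rw [← e, b1 _ (by omega), show i + p.target + d + q.target + 0 = i + p.target + d by omega]
        rw [show i + p.source + d + q.target + 0 = i + p.source + d by omega]
        rw [show i + p.target + d = i + p.target + d by omega, add_assoc _ _ d, a2, add_assoc]
      · rw [← e]; congr 1; omega
    · intro k hk
      dsimp only at hk ⊢
      rw [if_pos (by omega), b1 k (by omega), a1 k hk]
    · intro k
      dsimp only
      split_ifs with hk
      · rw [b1 _ (by omega), a2]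
      · congr 1; omega
    · rw [add_comm]
      congr 1
      · apply weight_congr
        · intro k hk
          rw [show i + p.target + d + k = i + p.target + (d + k) by omega, a2]
          congr 1; omega
        · intro k hk
          split_ifs with hk'
          · have : k = 0 := by omega
            subst this
            rw [b1 _ (by omega), add_zero, add_zero, a2]
          · congr 1; omega
      · apply weight_congr
        · intro k hk
          rw [if_pos (by omega)]
        · intro k hk
          rw [b1 _ (by omega)]
  · rintro ⟨h, ⟨a1, a2⟩, ⟨b1, b2⟩, rfl⟩
    refine ⟨fun k => if k ≤ i + p.target + d then g' k else g (k - p.target - i + p.source + i),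
      ⟨?_, ?_⟩, ⟨?_, ?_⟩, ?_⟩
    · intro k hk
      dsimp only at hk ⊢
      rw [if_pos (by omega), b1 k hk, a1 k (by omega)]
    · intro k
      dsimp only
      split_ifs with hk
      · rw [b2, a1 _ (by omega)]
      · congr 1; omega
    · intro k hk; dsimp only at hk ⊢; rw [if_pos hk]
    · intro k
      dsimp only
      have e : g' (i + p.target + d + q.target + k) = g (i + p.source + d + q.source + k) := by
        rw [show i + p.target + d + q.target + k = i + p.target + (d + q.target + k) by omega,
          b2, show i + p.source + (d + q.target + k) = i + p.source + d + q.target + k by omega, a2]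
      split_ifs with hk
      · have : q.source = 0 := by omega
        have : k = 0 := by omega
        subst this
        rw [e, show i + p.target + d + q.source + 0 = i + p.target + d by omega, add_assoc, b2,
          ← add_assoc, a1 _ (by omega)]
        congr 1; omega
      · rw [e]; congr 1; omega
    · rw [add_comm]
      congr 1
      · apply weight_congr
        · intro k hk
          rw [a1 _ (by omega)]
        · intro k hk
          rw [if_pos (by omega)]
      · apply weight_congr
        · intro k hk
          split_ifs with hk'
          · have : k = 0 := by omega
            subst this
            rw [add_zero, add_zero, add_assoc _ _ d, b2, ← add_assoc, a1 _ (by omega)]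
          · congr 1; omega
        · intro k hk
          rw [show i + p.target + d + k = i + p.target + (d + k) by omega, b2]
          congr 1; omega

theorem shades_zigzag_up (i : ℕ) {g g' : ℕ → Bool} {k : ℕ × ℕ} :
    Shades [cup i, cap (i + 1)] g k g' ↔ Shades [] g k g' := by
  rw [shades_pair]
  simp only [Continues, weight, Piece.source, Piece.target, Shades]
  constructor
  · rintro ⟨h, ⟨a1, a2⟩, ⟨b1, b2⟩, rfl⟩
    refine ⟨funext fun k => ?_, rfl⟩
    rcases le_or_gt k i with hk | hk
    · rw [b1 k (by omega), a1 k hk]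
    · obtain ⟨l, rfl⟩ := Nat.exists_eq_add_of_lt hk
      have e1 := b2 l
      have e2 := a2 (l + 1)
      rw [show i + l + 1 = i + 1 + 0 + l by omega, e1,
        show i + 1 + 2 + l = i + 2 + (l + 1) by omega, e2]
      congr 1; omega
  · rintro ⟨rfl, rfl⟩
    refine ⟨fun k => if k ≤ i + 1 then g k else g (k - 2), ⟨?_, ?_⟩, ⟨?_, ?_⟩, rfl⟩ <;> dsimp only
    · intro k hk; rw [if_pos (by omega)]
    · intro k; rw [if_neg (by omega)]; congr 1; omega
    · intro k hk; rw [if_pos hk]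
    · intro k; rw [if_neg (by omega)]; congr 1; omega

theorem shades_zigzag_down (i : ℕ) {g g' : ℕ → Bool} {k : ℕ × ℕ} :
    Shades [cup (i + 1), cap i] g k g' ↔ Shades [] g k g' := by
  rw [shades_pair]
  simp only [Continues, weight, Piece.source, Piece.target, Shades]
  constructor
  · rintro ⟨h, ⟨a1, a2⟩, ⟨b1, b2⟩, rfl⟩
    refine ⟨funext fun k => ?_, rfl⟩
    rcases le_or_gt k i with hk | hk
    · rw [b1 k hk, a1 k (by omega)]
    · obtain ⟨l, rfl⟩ := Nat.exists_eq_add_of_lt hk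
      have e1 := b2 (l + 1)
      have e2 := a2 l
      rw [show i + l + 1 = i + 0 + (l + 1) by omega, e1,
        show i + 2 + (l + 1) = i + 1 + 2 + l by omega, e2]
      congr 1; omega
  · rintro ⟨rfl, rfl⟩
    refine ⟨fun k => if k ≤ i + 1 then g k else g (k - 2), ⟨?_, ?_⟩, ⟨?_, ?_⟩, rfl⟩ <;> dsimp only
    · intro k hk; rw [if_pos hk]
    · intro k; rw [if_neg (by omega)]; congr 1; omega
    · intro k hk; rw [if_pos (by omega)]
    · intro k
      split_ifs with hk
      · have : k = 0 ∨ k = 1 := by omega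
        omega
      · congr 1; omega

theorem shades_slide_cup (i : ℕ) (b : Bool) {g g' : ℕ → Bool} {k : ℕ × ℕ} :
    Shades [cup i, cross (i + 1) b] g k g' ↔ Shades [cup (i + 1), cross i (!b)] g k g' := by
  rw [shades_pair, shades_pair]
  simp only [Continues, weight, Piece.source, Piece.target, Bool.not_not, add_zero]
  constructor
  · rintro ⟨h, ⟨a1, a2⟩, ⟨b1, b2⟩, rfl⟩
    have c0 := a1 i le_rfl
    have c2 := a2 0
    have c3 := a2 1
    have d0 := b1 i (by omega)
    have d1 := b1 (i + 1) le_rfl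
    have d3 := b2 0
    simp only [add_zero, show i + 2 + 1 = i + 3 from rfl]
      at c2 c3 d3 ⊢
    refine ⟨fun k => if k ≤ i + 1 then g k else if k = i + 2 then g' k else g (k - 2),
      ⟨?_, ?_⟩, ⟨?_, ?_⟩, ?_⟩
    · intro k hk; simp [hk]
    · intro k; simp only [show ¬ i + 3 + k ≤ i + 1 by omega, show ¬ i + 3 + k = i + 2 by omega,
        if_false]; congr 1; omega
    · intro k hk; simp only [show k ≤ i + 1 by omega, if_true]; rw [b1 k (by omega), a1 k hk]
    · rintro (_ | k)
      · simp
      · simp only [show ¬ i + 2 + (k + 1) ≤ i + 1 by omega,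
          show ¬ i + 2 + (k + 1) = i + 2 by omega, if_false]
        rw [show i + 2 + (k + 1) = i + 3 + k by omega, b2,
          show i + 3 + k = i + 2 + (k + 1) by omega, a2]
        congr 1; omega
    · simp only [c2, c3, d1]
      simp
      abel
  · rintro ⟨h, ⟨a1, a2⟩, ⟨b1, b2⟩, rfl⟩
    have c0 := a1 i (by omega)
    have c1 := a1 (i + 1) le_rfl
    have c3 := a2 0
    have d0 := b1 i le_rfl
    have d2 := b2 0
    simp only [add_zero, show i + 1 + 2 = i + 3 from rfl] at c3 d2 ⊢
    refine ⟨fun k => if k ≤ i then g k else if k = i + 1 then g' k else g (k - 2),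
      ⟨?_, ?_⟩, ⟨?_, ?_⟩, ?_⟩
    · intro k hk; simp [hk]
    · intro k; simp only [show ¬ i + 2 + k ≤ i by omega, show ¬ i + 2 + k = i + 1 by omega,
        if_false]; congr 1; omega
    · intro k hk
      dsimp only
      split_ifs with h1 h2
      · rw [b1 k h1, a1 k hk]
      · rfl
      · omega
    · intro k
      simp only [show ¬ i + 3 + k ≤ i by omega, show ¬ i + 3 + k = i + 1 by omega, if_false]
      rw [show i + 3 + k = i + 2 + (k + 1) by omega, b2,
        show i + 2 + (k + 1) = i + 3 + k by omega, a2]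
      congr 1; omega
    · simp only [c0, c1, d2]
      simp
      abel

theorem shades_slide_cap (i : ℕ) (b : Bool) {g g' : ℕ → Bool} {k : ℕ × ℕ} :
    Shades [cross (i + 1) b, cap i] g k g' ↔ Shades [cross i (!b), cap (i + 1)] g k g' := by
  rw [shades_pair, shades_pair]
  simp only [Continues, weight, Piece.source, Piece.target, Bool.not_not, add_zero]
  constructor
  · rintro ⟨h, ⟨a1, a2⟩, ⟨b1, b2⟩, rfl⟩
    have c0 := a1 i (by omega)
    have c1 := a1 (i + 1) le_rfl
    have c3 := a2 0
    have d0 := b1 i le_rfl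
    have d1 := b2 0
    have d2 := b2 1
    simp only [add_zero, show i + 2 + 1 = i + 3 from rfl]
      at c3 d1 d2 ⊢
    refine ⟨fun k => if k = i + 1 then g' k else g k, ⟨?_, ?_⟩, ⟨?_, ?_⟩, ?_⟩
    · intro k hk; simp [show k ≠ i + 1 by omega]
    · intro k; simp [show i + 2 + k ≠ i + 1 by omega]
    · intro k hk
      dsimp only
      split_ifs with h1
      · rfl
      · rw [b1 k (by omega), a1 k (by omega)]
    · intro k
      simp only [show i + 3 + k ≠ i + 1 by omega, if_false]
      rw [show i + 1 + k = i + (k + 1) by omega, b2, show i + 2 + (k + 1) = i + 3 + k by omega, a2]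
    · have : g i = h (i + 2) := by rw [← c0, ← d0, d1]
      simp only [this, d2, c3]
      simp
      abel
  · rintro ⟨h, ⟨a1, a2⟩, ⟨b1, b2⟩, rfl⟩
    have c0 := a1 i le_rfl
    have c2 := a2 0
    have c3 := a2 1
    have d0 := b1 i (by omega)
    have d1 := b1 (i + 1) le_rfl
    have d3 := b2 0
    simp only [add_zero, show i + 2 + 1 = i + 3 from rfl]
      at c2 c3 d3 ⊢
    refine ⟨fun k => if k = i + 2 then g' i else g k, ⟨?_, ?_⟩, ⟨?_, ?_⟩, ?_⟩
    · intro k hk; simp [show k ≠ i + 2 by omega]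
    · intro k; simp [show i + 3 + k ≠ i + 2 by omega]
    · intro k hk
      dsimp only
      rw [if_neg (by omega), b1 k (by omega), a1 k hk]
    · rintro (_ | _ | k)
      · simp
      · simp only [zero_add, show i + 2 + 1 ≠ i + 2 by omega, if_false]
        rw [d3, c3]
      · simp only [show i + 2 + (k + 1 + 1) ≠ i + 2 by omega, if_false]
        rw [show i + (k + 1 + 1) = i + 1 + (k + 1) by omega, b2,
          show i + 3 + (k + 1) = i + 2 + (k + 2) by omega, a2]
    · have e1 : g (i + 3) = h (i + 1) := by rw [← c3, ← d3, d1]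
      have e2 : g' i = g i := by rw [d0, c0]
      simp only [e1, e2]
      simp
      abel

theorem PlanarRule.shades_iff {l r : List Slice} (h : PlanarRule l r) {g g' : ℕ → Bool}
    {k : ℕ × ℕ} : Shades l g k g' ↔ Shades r g k g' := by
  cases h with
  | exchange p q i d => exact shades_exchange p q i d
  | zigzag_up i => exact shades_zigzag_up i
  | zigzag_down i => exact shades_zigzag_down i
  | slide_cup i b => exact shades_slide_cup i b
  | slide_cap i b => exact shades_slide_cap i b

theorem PlanarIsotopic.shades_iff {p q : ℕ} {D E : TangleDiagram p q} (h : PlanarIsotopic D E)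
    {g g' : ℕ → Bool} {k : ℕ × ℕ} : Shades D.word g k g' ↔ Shades E.word g k g' := by
  induction h with
  | rel D E h =>
    obtain ⟨u, l, r, v, hR, hD, hE⟩ := h
    simp only [hD, hE, shades_append, hR.shades_iff]
  | refl D => rfl
  | symm D E _ ih => exact ih.symm
  | trans D E F _ _ h1 h2 => exact h1.trans h2

theorem crossingCount_append (u v : List Slice) :
    crossingCount (u ++ v) = crossingCount u + crossingCount v :=
  List.countP_append

theorem PlanarRule.crossingCount_eq {l r : List Slice} (h : PlanarRule l r) :
    crossingCount l = crossingCount r := by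
  cases h with
  | exchange p q i d =>
    simp only [crossingCount, List.countP_cons, List.countP_nil]
    omega
  | zigzag_up i => rfl
  | zigzag_down i => rfl
  | slide_cup i b => cases b <;> rfl
  | slide_cap i b => cases b <;> rfl

theorem PlanarIsotopic.crossings_eq {p q : ℕ} {D E : TangleDiagram p q}
    (h : PlanarIsotopic D E) : D.crossings = E.crossings := by
  induction h with
  | rel D E h =>
    obtain ⟨u, l, r, v, hR, hD, hE⟩ := h
    simp only [TangleDiagram.crossings, hD, hE, crossingCount_append, hR.crossingCount_eq]
  | refl D => rfl
  | symm D E _ ih => exact ih.symm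
  | trans D E F _ _ h1 h2 => exact h1.trans h2

/-! ### Shadings that detect Reidemeister moves -/

/-- The weights of a union of regions none of which is a monogon, a bigon with corners of both
types, or a triangle with corners of both types. -/
def Allowed (k : ℕ × ℕ) : Prop :=
  4 ≤ k.1 + k.2 ∨ (k.1 = 0 ∧ k.2 ≠ 1) ∨ (k.2 = 0 ∧ k.1 ≠ 1)

theorem Allowed.add {k l : ℕ × ℕ} (hk : Allowed k) (hl : Allowed l) : Allowed (k + l) := by
  unfold Allowed at *
  simp only [Prod.fst_add, Prod.snd_add]
  omega

/-- The shading in which no region is shaded. -/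
abbrev unshaded : ℕ → Bool := fun _ => false

/-- The shading in which only the gap `i` is shaded. -/
def onlyGap (i : ℕ) : ℕ → Bool := fun k => decide (k = i)

/-- Outside the place of a move nothing needs to be shaded. -/
theorem shades_unshaded (w : List Slice) : Shades w unshaded 0 unshaded := by
  induction w with
  | nil => exact ⟨rfl, rfl⟩
  | cons s w ih =>
    refine ⟨unshaded, 0, ⟨fun _ _ => rfl, fun _ => rfl⟩, ih, ?_⟩
    unfold weight
    split <;> simp [shaded]

theorem shades_context {u v w : List Slice} {k : ℕ × ℕ} (h : Shades w unshaded k unshaded) :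
    Shades (u ++ w ++ v) unshaded k unshaded :=
  shades_append.2 ⟨unshaded, k, 0,
    shades_append.2 ⟨unshaded, 0, k, shades_unshaded u, h, (zero_add k).symm⟩,
    shades_unshaded v, (add_zero k).symm⟩

/-- A curl is a monogon. -/
theorem shades_curl (i : ℕ) (b : Bool) :
    Shades [cross i b, cap i] unshaded (oneCorner b) unshaded := by
  rw [shades_pair]
  refine ⟨onlyGap (i + 1), ⟨?_, ?_⟩, ⟨?_, ?_⟩, ?_⟩
  all_goals simp [onlyGap, weight, shaded, Piece.source, Piece.target]
  all_goals first | (intros; omega) | (intros; exact decide_eq_false (by omega))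

/-- The bigon removed by the second move has corners of both types. -/
theorem shades_bigon (i : ℕ) (b : Bool) :
    Shades [cross i b, cross i (!b)] unshaded (1, 1) unshaded := by
  rw [shades_pair]
  refine ⟨onlyGap (i + 1), ⟨?_, ?_⟩, ⟨?_, ?_⟩, ?_⟩
  all_goals simp [onlyGap, weight, shaded, Piece.source, Piece.target]
  all_goals first
    | (intros; omega) | (intros; exact decide_eq_false (by omega)) | (cases b <;> rfl)

theorem shades_triangle_up (i : ℕ) (a b c : Bool) :
    Shades [cross i a, cross (i + 1) b, cross i c] unshaded (oneCorner a + oneCorner (!b) + oneCorner c)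
      unshaded := by
  refine ⟨onlyGap (i + 1), oneCorner (!b) + oneCorner c, ⟨?_, ?_⟩,
    ⟨onlyGap (i + 1), oneCorner c, ⟨?_, ?_⟩, ⟨unshaded, 0, ⟨?_, ?_⟩, ⟨rfl, rfl⟩, ?_⟩, ?_⟩, ?_⟩
  all_goals simp [onlyGap, weight, shaded, Piece.source, Piece.target, add_assoc]
  all_goals omega

theorem shades_triangle_down (i : ℕ) (a b c : Bool) :
    Shades [cross (i + 1) c, cross i b, cross (i + 1) a] unshaded
      (oneCorner a + oneCorner (!b) + oneCorner c) unshaded := by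
  refine ⟨onlyGap (i + 2), oneCorner (!b) + oneCorner a, ⟨?_, ?_⟩,
    ⟨onlyGap (i + 2), oneCorner a, ⟨?_, ?_⟩, ⟨unshaded, 0, ⟨?_, ?_⟩, ⟨rfl, rfl⟩, ?_⟩, ?_⟩, ?_⟩
  all_goals simp [onlyGap, weight, shaded, Piece.source, Piece.target]
  all_goals first
    | (intros; omega) | (intros; exact decide_eq_false (by omega)) | exact add_rotate _ _ _ | abel

/-- If every shading that vanishes at both ends has an allowed weight, then no planar isotopic
diagram admits a simplifying first or second move or a third move in either direction. -/
theorem crossings_lt_of_allowed {p q : ℕ} {D E : TangleDiagram p q}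
    (hD : ∀ k, Shades D.word unshaded k unshaded → Allowed k) (h : ReidemeisterMove D E) :
    D.crossings < E.crossings := by
  obtain ⟨D₁, E₁, h1, h2, h3⟩ := h
  rw [h1.crossings_eq, ← h3.crossings_eq]
  replace hD : ∀ k, Shades D₁.word unshaded k unshaded → Allowed k :=
    fun k hk => hD k (h1.shades_iff.2 hk)
  rcases h2 with ⟨u, l, r, v, hR, hD₁, hE₁⟩ | ⟨u, l, r, v, hR, hE₁, hD₁⟩
  · exfalso
    rw [hD₁] at hD
    cases hR with
    | one i b =>
      have := hD _ (shades_context (shades_curl i b))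
      cases b <;> simp [Allowed, oneCorner] at this
    | two i b =>
      have := hD _ (shades_context (shades_bigon i b))
      simp [Allowed] at this
    | three i a b c h =>
      have := hD _ (shades_context (shades_triangle_up i a b c))
      cases a <;> cases b <;> cases c <;> simp [Allowed, oneCorner] at this h
  · cases hR with
    | one i b =>
      simp only [TangleDiagram.crossings, hD₁, hE₁, crossingCount_append]
      cases b <;> simp [crossingCount]
    | two i b =>
      simp only [TangleDiagram.crossings, hD₁, hE₁, crossingCount_append]
      cases b <;> simp [crossingCount]
    | three i a b c h =>
      exfalso
      rw [hD₁] at hD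
      have := hD _ (shades_context (shades_triangle_down i a b c))
      cases a <;> cases b <;> cases c <;> simp [Allowed, oneCorner] at this h

/-! ### Words of twists -/

/-- The position of the twists with odd (`o = true`) or even (`o = false`) index. -/
def lane (o : Bool) : ℕ := if o then 0 else 1

/-- The crossings of a block of `d` twists of the two lower (`o = true`) or upper (`o = false`)
strands are `cross (lane o) (twistSign o d)`. -/
def twistSign (o : Bool) (d : ℤ) : Bool := if o then decide (0 < d) else decide (d < 0)

theorem twistSign_of_pos (o : Bool) {d : ℤ} (h : 0 < d) : twistSign o d = o := by
  cases o <;> simp [twistSign, h, h.le]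

theorem twistSign_of_neg (o : Bool) {d : ℤ} (h : d < 0) : twistSign o d = !o := by
  cases o <;> simp [twistSign, h, h.le]

/-- The twists of `l`, of which the first one has odd index if `o = true`, followed by the arc on
the right that belongs to the parity of the last index. -/
def closedTwists : Bool → List ℤ → List Slice
  | o, [] => [cap (lane o)]
  | o, d :: l => List.replicate d.natAbs (cross (lane o) (twistSign o d)) ++ closedTwists (!o) l

theorem twists_append_cap (o : Bool) (l : List ℤ) :
    twists o l ++ [cap (lane (if Odd l.length then !o else o))] = closedTwists o l := by
  induction l generalizing o with
  | nil => cases o <;> rfl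
  | cons d l ih =>
    rw [closedTwists, ← ih]
    cases o <;> by_cases h : Odd l.length <;>
      simp [twists, lane, twistSign, h, Nat.odd_add_one, -Nat.not_odd_iff_even]

theorem conway_word (l : List ℤ) : (conway l).word = cup 1 :: closedTwists true l := by
  rw [← twists_append_cap]
  simp only [conway, lastCap]
  split_ifs <;> simp [lane]

/-! ### Shadings of words of twists -/

/-- The word `w` of twists of three strands with its cap is such that the shadings that vanish on
the unbounded regions have an allowed weight, apart from the weight that comes from the two bounded
regions which reach the left end of `w`: these have weight `u` (for the gap changed by twists in
`lane o`) and `v` (for the gap changed by the other twists). -/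
def Tame (o : Bool) (w : List Slice) (u v : ℕ × ℕ) : Prop :=
  ∀ g k, g 0 = false → (∀ i, g (i + 3) = false) → Shades w g k unshaded →
    ∃ l, Allowed l ∧ k = l + (shaded (g (lane o + 1)) u + shaded (g (lane (!o) + 1)) v)

theorem Tame.swap {o : Bool} {w : List Slice} {u v : ℕ × ℕ} (h : Tame o w u v) :
    Tame (!o) w v u := by
  intro g k h0 h3 hk
  obtain ⟨l, hl, rfl⟩ := h g k h0 h3 hk
  exact ⟨l, hl, by rw [Bool.not_not, add_comm (shaded _ v)]⟩

theorem allowed_zero : Allowed 0 := by simp [Allowed]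

theorem Allowed.shaded {u : ℕ × ℕ} (h : Allowed u) (x : Bool) : Allowed (shaded x u) := by
  cases x
  · exact allowed_zero
  · exact h

theorem shaded_add (x : Bool) (u v : ℕ × ℕ) : shaded x (u + v) = shaded x u + shaded x v := by
  cases x <;> rfl

theorem weight_lane (o b : Bool) {g h : ℕ → Bool} (h0 : g 0 = false) (h3 : g 3 = false) :
    weight (cross (lane o) b) g h = shaded (g (lane o + 1)) (oneCorner b) +
      shaded (h (lane o + 1)) (oneCorner b) + shaded (g (lane (!o) + 1)) (oneCorner (!b)) := by
  cases o <;> simp [weight, lane, h0, h3, shaded]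

/-- One more crossing closes the region in its own gap, which obtains its last corner, and adds a
corner to the region in the other gap. -/
theorem Tame.cross {o : Bool} {w : List Slice} {u v : ℕ × ℕ} (hw : Tame o w u v) {b : Bool}
    (hu : Allowed (oneCorner b + u)) :
    Tame o (cross (lane o) b :: w) (oneCorner b) (oneCorner (!b) + v) := by
  rintro g k h0 h3 ⟨h, l, ⟨c1, c2⟩, hl, rfl⟩
  dsimp only [Piece.source, Piece.target] at c1 c2
  have e0 : h 0 = false := by rw [c1 0 (Nat.zero_le _), h0]
  have e3 : ∀ i, h (i + 3) = false := by
    intro i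
    have : ∃ j, i + 3 = lane o + 2 + j :=
      ⟨i + 3 - (lane o + 2), by cases o <;> simp [lane] <;> omega⟩
    obtain ⟨j, hj⟩ := this
    rw [hj, c2, ← hj, h3]
  have eo : h (lane (!o) + 1) = g (lane (!o) + 1) := by
    cases o
    · exact c1 1 le_rfl
    · exact c2 0
  obtain ⟨a, ha, rfl⟩ := hw h l e0 e3 hl
  refine ⟨a + shaded (h (lane o + 1)) (oneCorner b + u), ha.add (hu.shaded _), ?_⟩
  rw [weight_lane o b h0 (h3 0), eo, shaded_add, shaded_add]
  abel

/-- A region between two consecutive crossings of a block is a bigon with corners of one type. -/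
theorem allowed_bigon (b : Bool) : Allowed (oneCorner b + oneCorner b) := by
  cases b <;> simp [Allowed, oneCorner]

theorem Tame.block {o : Bool} {w : List Slice} {u v : ℕ × ℕ} (hw : Tame o w u v) {b : Bool}
    (hu : Allowed (oneCorner b + u)) (n : ℕ) :
    Tame o (List.replicate (n + 1) (Trigonal.cross (lane o) b) ++ w) (oneCorner b)
      ((n + 1) • oneCorner (!b) + v) := by
  induction n with
  | zero => simpa using hw.cross hu
  | succ n ih =>
    have := ih.cross (allowed_bigon b)
    rw [← add_assoc, ← succ_nsmul'] at this
    exact this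

theorem tame_cap (o b : Bool) :
    Tame o [cross (lane o) b, cap (lane (!o))] (oneCorner b) (oneCorner (!b)) := by
  intro g k h0 h3 hk
  rw [shades_pair] at hk
  obtain ⟨h, ⟨c1, c2⟩, ⟨d1, d2⟩, rfl⟩ := hk
  dsimp only [Piece.source, Piece.target] at c1 c2 d1 d2
  have e : h (lane o + 1) = false := by
    cases o
    · exact (d2 0).symm
    · exact (d1 1 le_rfl).symm
  refine ⟨0, allowed_zero, ?_⟩
  rw [weight_lane o b h0 (h3 0), e]
  simp [weight, shaded]

/-- In the last block the region in the gap of the twists reaches, after its last crossing, the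
unbounded region; the region in the other gap is closed by the cap and has a corner at each twist. -/
theorem tame_block_cap (o b : Bool) (n : ℕ) :
    Tame o (List.replicate (n + 1) (cross (lane o) b) ++ [cap (lane (!o))]) (oneCorner b)
      ((n + 1) • oneCorner (!b)) := by
  induction n with
  | zero => simpa using tame_cap o b
  | succ n ih =>
    have := ih.cross (allowed_bigon b)
    rw [← succ_nsmul'] at this
    exact this

/-! ### The hard sequences -/

/-- The sequence `2 e, -2 e, …, ± 2 e, ∓ (n + 1) e` with `a` terms `± 2 e`. -/
def zigzagSeq (n e : ℤ) : ℕ → List ℤ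
  | 0 => [e * (n + 1)]
  | a + 1 => e * 2 :: zigzagSeq n (-e) a

theorem zigzagSeq_eq (n e : ℤ) (a : ℕ) : zigzagSeq n e a =
    (List.range a).map (fun j => e * (-1) ^ j * 2) ++ [e * (-1) ^ a * (n + 1)] := by
  induction a generalizing e with
  | zero => simp [zigzagSeq]
  | succ a ih =>
    rw [zigzagSeq, ih, List.range_succ_eq_map]
    simp only [List.map_cons, List.map_map, List.cons_append, pow_zero, mul_one]
    congr 2
    · apply List.map_congr_left
      intro j _
      simp only [Function.comp, Nat.succ_eq_add_one]
      ring
    · congr 1; ring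

theorem hardSequence_eq (x : List ℤ) (m : ℤ) (a : ℕ) (n : ℤ) :
    hardSequence x m (a + 1) n = x ++ (m + 1) :: zigzagSeq n (-1) a := by
  rw [hardSequence, zigzagSeq_eq]
  simp [pow_succ]

/-- All crossings of a sequence whose signs alternate have the same sign `b` in the plane. -/
theorem closedTwists_zigzagSeq_zero (o b : Bool) {n : ℕ} {e : ℤ}
    (he : (b = o ∧ e = 1) ∨ (b = !o ∧ e = -1)) :
    closedTwists o (zigzagSeq n e 0) =
      List.replicate (n + 1) (cross (lane o) b) ++ [cap (lane (!o))] := by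
  rcases he with ⟨rfl, rfl⟩ | ⟨rfl, rfl⟩
  · rw [zigzagSeq, closedTwists, twistSign_of_pos _ (by omega), closedTwists]
    congr 2
    omega
  · rw [zigzagSeq, closedTwists, twistSign_of_neg _ (by omega), closedTwists]
    congr 2
    omega

theorem closedTwists_zigzagSeq_succ (o b : Bool) {n : ℕ} {e : ℤ} (a : ℕ)
    (he : (b = o ∧ e = 1) ∨ (b = !o ∧ e = -1)) :
    closedTwists o (zigzagSeq n e (a + 1)) =
      List.replicate 2 (cross (lane o) b) ++ closedTwists (!o) (zigzagSeq n (-e) a) := by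
  rcases he with ⟨rfl, rfl⟩ | ⟨rfl, rfl⟩
  · rw [zigzagSeq, closedTwists, twistSign_of_pos _ (by omega)]
    rfl
  · rw [zigzagSeq, closedTwists, twistSign_of_neg _ (by omega)]
    rfl

theorem sign_step {o b : Bool} {e : ℤ} (he : (b = o ∧ e = 1) ∨ (b = !o ∧ e = -1)) :
    (b = !o ∧ -e = 1) ∨ (b = !(!o) ∧ -e = -1) := by
  rcases he with ⟨rfl, rfl⟩ | ⟨rfl, rfl⟩ <;> simp

/-- In the part of the diagram where the terms alternate in sign all crossings have the same sign in
the plane, and the regions other than the bigons inside blocks have at least four corners. -/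
theorem tame_zigzagSeq (o b : Bool) {n : ℕ} {e : ℤ} (a : ℕ) (hn : 2 ≤ n)
    (he : (b = o ∧ e = 1) ∨ (b = !o ∧ e = -1)) :
    ∃ v, Tame o (closedTwists o (zigzagSeq n e a)) (oneCorner b) v ∧ Allowed (oneCorner b + v) := by
  induction a generalizing o e with
  | zero =>
    rw [closedTwists_zigzagSeq_zero o b he]
    refine ⟨_, tame_block_cap o b n, Or.inl ?_⟩
    cases b <;> simp [oneCorner] <;> omega
  | succ a ih =>
    rw [closedTwists_zigzagSeq_succ o b a he]
    obtain ⟨v, hv, hv'⟩ := ih (!o) (sign_step he)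
    have := hv.swap
    rw [Bool.not_not] at this
    refine ⟨_, this.block hv' 1, Or.inl ?_⟩
    cases b <;> simp [oneCorner]

/-- The part with positive terms is alternating: each of its regions only has corners of one type,
apart from the one that it shares with the tail. -/
theorem tame_positive {n m a : ℕ} (hm : 1 ≤ m) (hn : 2 ≤ n) (x : List ℤ) (hx : ∀ d ∈ x, 0 < d)
    (o : Bool) :
    ∃ v, Tame o (closedTwists o (x ++ (m + 1 : ℤ) :: zigzagSeq n (-1) a)) (oneCorner o) v ∧
      Allowed (oneCorner (!o) + v) ∧ (2 ≤ m ∨ x ≠ [] → Allowed v) := by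
  induction x generalizing o with
  | nil =>
    obtain ⟨v, hv, hv'⟩ := tame_zigzagSeq (!o) o (n := n) (e := -1) a hn (by simp)
    have := hv.swap
    rw [Bool.not_not] at this
    rw [List.nil_append, closedTwists, twistSign_of_pos _ (by omega)]
    refine ⟨_, this.block hv' m, Or.inl ?_, ?_⟩
    · cases o <;> simp [oneCorner] <;> omega
    · rintro (h | h)
      · left
        cases o <;> simp [oneCorner] <;> omega
      · exact absurd rfl h
  | cons d x ih =>
    obtain ⟨v, hv, hv', -⟩ := ih (fun c hc => hx c (List.mem_cons_of_mem _ hc)) (!o)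
    have hd := hx d List.mem_cons_self
    have := hv.swap
    rw [Bool.not_not] at this hv'
    obtain ⟨c, hc⟩ : ∃ c, d.natAbs = c + 1 := ⟨d.natAbs - 1, by omega⟩
    rw [List.cons_append, closedTwists, twistSign_of_pos _ hd, hc]
    refine ⟨_, this.block hv' c, ?_, fun _ => ?_⟩
    · cases o <;> simp [oneCorner, Allowed]
    · cases o <;> simp [oneCorner, Allowed]

theorem isHard_hardSequence {x : List ℤ} {m a n : ℕ} (hx : ∀ d ∈ x, 0 < d) (hm : 1 ≤ m)
    (hm' : 2 ≤ m ∨ x ≠ []) (hn : 2 ≤ n) : IsHard (hardSequence x m (a + 1) n) where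
  ne_zero := by
    intro d hd
    rw [hardSequence] at hd
    simp only [List.mem_append, List.mem_map, List.mem_singleton] at hd
    rcases hd with ((hd | rfl) | ⟨j, -, rfl⟩) | rfl
    · exact (hx d hd).ne'
    · omega
    · positivity
    · exact mul_ne_zero (by positivity) (by omega)
  not_alternating := by
    rw [hardSequence_eq]
    rintro (h | h)
    · have : ∃ d ∈ zigzagSeq n (-1) a, d < 0 := by
        cases a with
        | zero => exact ⟨-1 * (n + 1), List.mem_cons_self, by omega⟩
        | succ a => exact ⟨-1 * 2, List.mem_cons_self, by omega⟩
      obtain ⟨d, hd, hd'⟩ := this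
      exact absurd (h d (by simp [hd])) (by omega)
    · exact absurd (h (m + 1) (by simp)) (by omega)
  crossings_lt := by
    intro E hE
    refine crossings_lt_of_allowed ?_ hE
    rw [conway_word, hardSequence_eq]
    rintro k ⟨g, l, ⟨c1, c2⟩, hl, rfl⟩
    obtain ⟨v, hv, -, hv'⟩ := tame_positive (a := a) hm hn x hx true
    dsimp only [Piece.source, Piece.target] at c1 c2
    obtain ⟨t, ht, rfl⟩ := hv g l (c1 0 (by omega)) (fun i => by rw [add_comm]; exact c2 i) hl
    have : g (lane true + 1) = false := c1 1 le_rfl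
    rw [this]
    simpa [weight, shaded] using ht.add ((hv' hm').shaded (g (lane (!true) + 1)))

/-! ### Isotopies of words -/

theorem Replaces.map {R : List Slice → List Slice → Prop} {p q p' q' : ℕ}
    {F : TangleDiagram p q → TangleDiagram p' q'} {u v : List Slice}
    (hF : ∀ D, (F D).word = u ++ D.word ++ v) {D E : TangleDiagram p q} (h : Replaces R D E) :
    Replaces R (F D) (F E) := by
  obtain ⟨u', l, r, v', hR, hD, hE⟩ := h
  exact ⟨u ++ u', l, r, v' ++ v, hR, by simp [hF, hD], by simp [hF, hE]⟩

theorem PlanarIsotopic.map {p q p' q' : ℕ}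
    {F : TangleDiagram p q → TangleDiagram p' q'} {u v : List Slice}
    (hF : ∀ D, (F D).word = u ++ D.word ++ v) {D E : TangleDiagram p q}
    (h : PlanarIsotopic D E) : PlanarIsotopic (F D) (F E) := by
  induction h with
  | rel D E h => exact .rel _ _ (h.map hF)
  | refl D => exact .refl _
  | symm D E _ ih => exact .symm _ _ ih
  | trans D E G _ _ h1 h2 => exact .trans _ _ _ h1 h2

/-- Isotopies take place inside any larger diagram. -/
theorem SameLink.map {p q p' q' : ℕ}
    {F : TangleDiagram p q → TangleDiagram p' q'} {u v : List Slice}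
    (hF : ∀ D, (F D).word = u ++ D.word ++ v) {D E : TangleDiagram p q}
    (h : SameLink D E) : SameLink (F D) (F E) := by
  induction h with
  | rel D E h =>
    refine .rel _ _ (h.imp (fun h => h.map hF) ?_)
    rintro ⟨D', E', h1, h2, h3⟩
    exact ⟨F D', F E', h1.map hF, h2.imp (fun h => h.map hF) (fun h => h.map hF), h3.map hF⟩
  | refl D => exact .refl _
  | symm D E _ ih => exact .symm _ _ ih
  | trans D E G _ _ h1 h2 => exact .trans _ _ _ h1 h2

/-- Both words fit together to diagrams with `p` left and `q` right end points, and these diagrams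
represent isotopic tangles. -/
def SameTangle (p q : ℕ) (w w' : List Slice) : Prop :=
  ∃ (h : Fits p w q) (h' : Fits p w' q), SameLink (⟨w, h⟩ : TangleDiagram p q) ⟨w', h'⟩

namespace SameTangle

variable {p q r : ℕ} {w w' w'' : List Slice}

theorem refl (h : Fits p w q) : SameTangle p q w w := ⟨h, h, .refl _⟩

theorem symm (h : SameTangle p q w w') : SameTangle p q w' w := by
  obtain ⟨h1, h2, h⟩ := h
  exact ⟨h2, h1, .symm _ _ h⟩

theorem trans (h : SameTangle p q w w') (h' : SameTangle p q w' w'') : SameTangle p q w w'' := by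
  obtain ⟨h1, h2, h⟩ := h
  obtain ⟨h3, h4, h'⟩ := h'
  exact ⟨h1, h4, .trans _ _ _ h h'⟩

theorem append_left {u : List Slice} (hu : Fits r u p) (h : SameTangle p q w w') :
    SameTangle r q (u ++ w) (u ++ w') := by
  obtain ⟨h1, h2, h⟩ := h
  exact ⟨hu.append h1, hu.append h2, h.map
    (F := fun D => (⟨u ++ D.word, hu.append D.fits⟩ : TangleDiagram r q)) (u := u) (v := [])
    (fun D => by simp)⟩

theorem append_right {u : List Slice} (h : SameTangle p q w w') (hu : Fits q u r) :
    SameTangle p r (w ++ u) (w' ++ u) := by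
  obtain ⟨h1, h2, h⟩ := h
  exact ⟨h1.append hu, h2.append hu, h.map
    (F := fun D => (⟨D.word ++ u, D.fits.append hu⟩ : TangleDiagram p r)) (u := []) (v := u)
    (fun D => by simp)⟩

theorem of_planarRule (hw : Fits p w q) (hw' : Fits p w' q) (h : PlanarRule w w') :
    SameTangle p q w w' :=
  ⟨hw, hw', .rel _ _ (.inl (.rel _ _ ⟨[], w, w', [], h, by simp, by simp⟩))⟩

theorem of_reidemeisterRule (hw : Fits p w q) (hw' : Fits p w' q) (h : ReidemeisterRule w w') :
    SameTangle p q w w' :=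
  ⟨hw, hw', .rel _ _ (.inr ⟨_, _, .refl _, .inl ⟨[], w, w', [], h, by simp, by simp⟩,
    .refl _⟩)⟩

end SameTangle

/-! ### Flypes of the last two blocks -/

/-- The generators of the braid group on three strands, of either sign. -/
abbrev gen (o b : Bool) : Slice := cross (lane o) b

theorem fits_gens (w : List (Bool × Bool)) : Fits 3 (w.map fun s => gen s.1 s.2) 3 := by
  induction w with
  | nil => exact Fits.nil 3
  | cons s w ih =>
    obtain ⟨o, b⟩ := s
    cases o
    · exact Fits.cons (cross 1 b) 0 _ _ ih
    · exact Fits.cons (cross 0 b) 1 _ _ ih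

theorem fits_gen (o b : Bool) : Fits 3 [gen o b] 3 := fits_gens [(o, b)]

theorem fits_gen_replicate (o b : Bool) (n : ℕ) : Fits 3 (List.replicate n (gen o b)) 3 := by
  simpa using fits_gens (List.replicate n (o, b))

theorem fits_cap (o : Bool) : Fits 3 [cap (lane o)] 1 := by
  cases o
  · exact Fits.cons (cap 1) 0 [] 1 (Fits.nil 1)
  · exact Fits.cons (cap 0) 1 [] 1 (Fits.nil 1)

theorem gen_cancel (o b : Bool) : SameTangle 3 3 [gen o b, gen o (!b)] [] :=
  .of_reidemeisterRule (fits_gens [(o, b), (o, !b)]) (Fits.nil 3) (.two _ _)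

/-- A third move in either position of the crossings. -/
theorem gen_braid (o : Bool) (a b c : Bool) (h : ¬ (a = c ∧ b ≠ a)) :
    SameTangle 3 3 [gen o a, gen (!o) b, gen o c] [gen (!o) c, gen o b, gen (!o) a] := by
  cases o
  · exact (SameTangle.of_reidemeisterRule (fits_gens [(true, c), (false, b), (true, a)])
      (fits_gens [(false, a), (true, b), (false, c)])
      (.three 0 c b a (fun h' => h ⟨h'.1.symm, h'.1 ▸ h'.2⟩))).symm
  · exact .of_reidemeisterRule (fits_gens [(true, a), (false, b), (true, c)])
      (fits_gens [(false, c), (true, b), (false, a)]) (.three 0 a b c h)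

/-- If `σ` and `τ` are the two generators with the same sign, moving `σ τ` to the right through
crossings of the first kind turns them into crossings of the second kind. Whatever their sign `c`
is, the third moves used here are not alternating. -/
theorem gen_pair_replicate (o b c : Bool) (n : ℕ) :
    SameTangle 3 3 ([gen o b, gen (!o) b] ++ List.replicate n (gen o c))
      (List.replicate n (gen (!o) c) ++ [gen o b, gen (!o) b]) := by
  induction n with
  | zero => exact .refl (fits_gens [(o, b), (!o, b)])
  | succ n ih =>
    have h1 : SameTangle 3 3 [gen o b, gen (!o) b, gen o c] [gen (!o) c, gen o b, gen (!o) b] :=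
      gen_braid o b b c (by simp)
    exact (h1.append_right (fits_gen_replicate o c n)).trans
      (ih.append_left (fits_gen (!o) c))

theorem gen_pair_cap (o b : Bool) :
    SameTangle 3 1 [gen o (!b), gen (!o) (!b), cap (lane (!o))] [gen (!o) b, cap (lane o)] := by
  have h1 : SameTangle 3 1 [gen (!o) (!b), cap (lane (!o))] [cap (lane (!o))] :=
    .of_reidemeisterRule ((fits_gen _ _).append (fits_cap _)) (fits_cap _) (.one _ _)
  have h2 : SameTangle 3 1 [gen o (!b), cap (lane (!o))] [gen (!o) b, cap (lane o)] := by
    have f1 := (fits_gen o (!b)).append (fits_cap (!o))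
    have f2 := (fits_gen (!o) b).append (fits_cap o)
    cases o
    · have := PlanarRule.slide_cap 0 (!b)
      rw [Bool.not_not] at this
      exact .of_planarRule f1 f2 this
    · exact (SameTangle.of_planarRule f2 f1 (.slide_cap 0 b)).symm
  exact (h1.append_left (fits_gen o (!b))).trans h2

/-- Write `σ = gen o b` and `τ = gen (!o) b`. Then `σ⁻¹ τ⁻ᵃ⁻¹ σⁿ⁺¹ = τ σ⁻ᵃ τⁿ⁺¹`, where the left
side is followed by the cap that absorbs `τ` and the right side by the cap that absorbs `σ`. -/
theorem flype (o b : Bool) (a n : ℕ) :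
    SameTangle 3 1
      ([gen o (!b)] ++ List.replicate (a + 1) (gen (!o) (!b)) ++ List.replicate (n + 1) (gen o b) ++
        [cap (lane (!o))])
      ([gen (!o) b] ++ List.replicate a (gen o (!b)) ++ List.replicate (n + 1) (gen (!o) b) ++
        [cap (lane o)]) := by
  have F := fits_gen_replicate
  have fg := fits_gen
  have fc := fits_cap
  -- With `1 = τ τ⁻¹` in front, the pair `τ⁻¹ σ⁻¹` can move to the right through all the `τ⁻¹`.
  have h1 : SameTangle 3 3 [] [gen (!o) b, gen (!o) (!b)] := (gen_cancel (!o) b).symm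
  have h2 := gen_pair_replicate (!o) (!b) (!b) (a + 1)
  rw [Bool.not_not] at h2
  have h3 : SameTangle 3 3 [gen o (!b), gen o b] [] := by
    simpa using gen_cancel o (!b)
  have h4 := gen_pair_replicate o (!b) b n
  have h5 := gen_pair_cap o b
  have s1 := (h1.append_right (fg o (!b))).append_right (F (!o) (!b) (a + 1))
  have s2 := h2.append_left (fg (!o) b)
  have s12 : SameTangle 3 3 ([gen o (!b)] ++ List.replicate (a + 1) (gen (!o) (!b)))
      ([gen (!o) b] ++ List.replicate a (gen o (!b)) ++
        [gen o (!b), gen (!o) (!b), gen o (!b)]) := by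
    refine (s1.trans (by simpa using s2)).trans ?_
    rw [List.replicate_succ']
    simpa using SameTangle.refl (((fg (!o) b).append (F o (!b) a)).append
      (fits_gens [(o, !b), (!o, !b), (o, !b)]))
  -- The last `σ⁻¹` cancels one `σ`, and the pair `σ⁻¹ τ⁻¹` moves through the other ones to the cap.
  have s3 := (h3.append_left (fits_gens [(o, !b), (!o, !b)])).append_right (F o b n)
  have s4 := (h4.append_right (fc (!o))).trans (by simpa using h5.append_left (F (!o) b n))
  have s34 : SameTangle 3 1 ([gen o (!b), gen (!o) (!b), gen o (!b)] ++
      List.replicate (n + 1) (gen o b) ++ [cap (lane (!o))])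
      (List.replicate (n + 1) (gen (!o) b) ++ [cap (lane o)]) := by
    have := (s3.append_right (fc (!o))).trans s4
    rw [List.replicate_succ' (a := gen (!o) b)]
    simpa [List.replicate_succ] using this
  have := (s12.append_right ((F o b (n + 1)).append (fc (!o)))).trans
    (by simpa using s34.append_left ((fg (!o) b).append (F o (!b) a)))
  simpa using this

/-- Iterated flypes turn the last two blocks into twists of alternating signs. After one flype
the word is `τ σ⁻ᵃ τⁿ⁺¹ = τ² (τ⁻¹ σ⁻ᵃ τⁿ⁺¹)`, and the second factor admits the next flype. -/
theorem sameTangle_zigzagSeq (o b : Bool) (a n : ℕ) {e : ℤ}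
    (he : (b = (!o) ∧ e = 1) ∨ (b = (!(!o)) ∧ e = -1)) :
    SameTangle 3 1
      ([gen o (!b)] ++ List.replicate (a + 1) (gen (!o) (!b)) ++ List.replicate (n + 1) (gen o b) ++
        [cap (lane (!o))])
      (closedTwists (!o) (zigzagSeq (n + 1 : ℕ) e a)) := by
  refine (flype o b a n).trans ?_
  induction a generalizing o e with
  | zero =>
    rw [closedTwists_zigzagSeq_zero (!o) b he]
    simpa [List.replicate_succ] using
      SameTangle.refl ((fits_gen_replicate (!o) b (n + 2)).append (fits_cap o))
  | succ a ih =>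
    rw [closedTwists_zigzagSeq_succ (!o) b a he]
    have h1 := flype (!o) b a n
    have h2 := ih (!o) (sign_step he)
    simp only [Bool.not_not] at h1 h2
    have h3 := (h1.trans h2).append_left (fits_gen_replicate (!o) b 2)
    have c : SameTangle 3 3 [gen (!o) b, gen (!o) (!b)] [] := gen_cancel (!o) b
    have h4 := ((c.append_left (fits_gen (!o) b)).append_right
      (((fits_gen_replicate o (!b) (a + 1)).append
        (fits_gen_replicate (!o) b (n + 1))).append (fits_cap o))).symm
    rw [Bool.not_not]
    refine SameTangle.trans ?_ h3
    simpa [List.replicate_succ] using h4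

/-- The flypes apply to a block of `m` twists after it is written as `m + 1` twists followed by an
opposite one. -/
theorem sameTangle_closedTwists (x : List ℤ) (m a n : ℕ) (o : Bool) :
    SameTangle 3 1 (closedTwists o (x ++ (m + 1 : ℤ) :: zigzagSeq (n + 1 : ℕ) (-1) a))
      (closedTwists o (x ++ [(m : ℤ), ((a + 1 : ℕ) : ℤ), ((n + 1 : ℕ) : ℤ)])) := by
  induction x generalizing o with
  | nil =>
    have pos : ∀ k : ℕ, (0 : ℤ) < ((k + 1 : ℕ) : ℤ) := fun k => by positivity
    have hm : List.replicate (m : ℤ).natAbs (gen o (twistSign o m)) =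
        List.replicate m (gen o o) := by
      cases m with
      | zero => rfl
      | succ m => rw [twistSign_of_pos _ (pos m), Int.natAbs_natCast]
    have h := sameTangle_zigzagSeq o o a n (e := -1) (by simp)
    have c : SameTangle 3 3 [gen o o, gen o (!o)] [] := gen_cancel o o
    have h1 := (h.append_left (fits_gen_replicate o o (m + 1))).symm
    have h2 := (c.append_left (fits_gen_replicate o o m)).append_right
      (((fits_gen_replicate (!o) (!o) (a + 1)).append
        (fits_gen_replicate o o (n + 1))).append (fits_cap (!o)))
    simp only [List.nil_append, closedTwists]
    rw [hm, twistSign_of_pos _ (pos a), twistSign_of_pos _ (pos n), Int.natAbs_natCast,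
      Int.natAbs_natCast, show (m + 1 : ℤ) = ((m + 1 : ℕ) : ℤ) by push_cast; rfl,
      twistSign_of_pos _ (pos m), Int.natAbs_natCast, Bool.not_not]
    refine h1.trans ?_
    simpa [List.replicate_succ'] using h2
  | cons d x ih => exact (ih (!o)).append_left (fits_gen_replicate _ _ _)

theorem isConwayDiagramOf_hardSequence {x : List ℤ} {m a n : ℕ} {K : LinkDiagram}
    (h : IsConwayDiagramOf (x ++ [(m : ℤ), ((a + 1 : ℕ) : ℤ), ((n + 1 : ℕ) : ℤ)]) K) :
    IsConwayDiagramOf (hardSequence x m (a + 1) (n + 1 : ℕ)) K := by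
  have f : Fits 1 [cup 1] 3 := Fits.cons (cup 1) 0 [] 3 (Fits.nil 3)
  have h1 := (sameTangle_closedTwists x m a n true).append_left f
  rw [List.singleton_append, List.singleton_append, ← hardSequence_eq, ← conway_word,
    ← conway_word] at h1
  obtain ⟨_, _, h1⟩ := h1
  exact .trans _ _ _ (h1.map (F := closeUp) (u := [cup 0]) (v := [cap 0]) fun D => rfl) h

end Trigonal

theorem mainTheorem2 (c : List ℤ) (hk : 3 ≤ c.length)
    (hfirst : ∀ m ∈ c.head?, 2 ≤ m) (hlast : ∀ m ∈ c.getLast?, 2 ≤ m)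
    (K : LinkDiagram) (hK : HasConwayNormalForm K c) :
    ∃ (x : List ℤ) (m : ℤ) (a : ℕ) (n : ℤ), c = x ++ [m, (a : ℤ), n] ∧
      IsConwayDiagramOf (hardSequence x m a n) K ∧ IsHard (hardSequence x m a n) := by
  obtain ⟨x, y, hxy, hy⟩ : ∃ x y, c = x ++ y ∧ y.length = 3 :=
    ⟨c.take (c.length - 3), c.drop (c.length - 3), (List.take_append_drop _ _).symm,
      by rw [List.length_drop]; omega⟩
  obtain ⟨m, a, n, rfl⟩ := List.length_eq_three.1 hy
  subst hxy
  obtain ⟨hpos, hK⟩ := hK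
  have hm : 0 < m := hpos m (by simp)
  have ha : 0 < a := hpos a (by simp)
  have hn : 2 ≤ n := hlast n (by simp)
  obtain ⟨m, rfl⟩ := Int.eq_ofNat_of_zero_le hm.le
  obtain ⟨a, rfl⟩ := Int.eq_succ_of_zero_lt ha
  obtain ⟨n, rfl⟩ := Int.eq_succ_of_zero_lt (show 0 < n by omega)
  have hm' : 2 ≤ m ∨ x ≠ [] := by
    by_cases hx : x = []
    · subst hx
      exact .inl (by exact_mod_cast hfirst m (by simp))
    · exact .inr hx
  exact ⟨x, m, a + 1, (n + 1 : ℕ), rfl, isConwayDiagramOf_hardSequence hK,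
    isHard_hardSequence (fun d hd => hpos d (by simp [hd])) (by omega) hm' (by omega)⟩
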